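/- Let $d\ge 1$ be an integer, let $R_0(w)\in\mathbb C[w]$ be a polynomial of degree $d$ with only simple zeros, and let $P(z,w)\in\mathbb C[z,w]$ be a polynomial of total degree at most $d$. For $\delta\in\mathbb C$ put $R_\delta(z,w)=R_0(w)+\delta P(z,w)$, let $\Gamma_\delta$ be the closure in $\hat{\mathbb C}\times\hat{\mathbb C}$ of $\{(z,w)\in\mathbb C^2: R_\delta(z,w)=0\}$, and let $F_\delta$ be the holomorphic correspondence on $\hat{\mathbb C}$ defined by $R_\delta$, that is, the multivalued map $F_\delta(z)=\{w\in\hat{\mathbb C}:(z,w)\in\Gamma_\delta\}$, where the points of $F_\delta(z)$ are counted with the multiplicity of the intersection of $\Gamma_\delta$ with $\{z\}\times\hat{\mathbb C}$ (if $R_\delta$ does not depend on $z$, then $F_\delta(z)$ consists of the zeros of $R_\delta$ for every $z\in\hat{\mathbb C}$). For a finite Borel measure $\mu$ on $\hat{\mathbb C}$ the push-forward $(F_\delta)_*\mu$ is the measure with $\langle (F_\delta)_*\mu,\phi\rangle=\int\sum_{x\in F_\delta(a)}\phi(x)\,d\mu(a)$ for continuous $\phi$, with multiplicities taken into account; in particular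 $(F_\delta)_*\delta_a=\sum_{x\in F_\delta(a)}\delta_x$, where $\delta_a$ is the Dirac measure at $a$. $F_\delta^m$ denotes the $m$-th iterate, with multiplicities. A set $S\subset\hat{\mathbb C}$ is forward invariant under $F_\delta$ if $F_\delta(S)\subset S$. For every $\epsilon>0$ there is $\Delta>0$ (depending on $R_0$, $P$ and $\epsilon$) such that for every $\delta\in\mathbb C$ with $|\delta|<\Delta$ there is a regular Borel probability measure $\mu_{F_\delta}$ on $\hat{\mathbb C}$ with the following properties. 1. $(F_\delta)_*\mu_{F_\delta}=d\,\mu_{F_\delta}$. 2. For every $a\in\mathbb C$, $\frac1{d^m}(F_\delta^m)_*\delta_a\to\mu_{F_\delta}$ in the weak* sense as $m\to\infty$. 3. $\operatorname{supp}\mu_{F_\delta}$ is contained in $\mathbb C$ and in the $\epsilon$-neighbourhood of the set of zeros of $R_0$. 4. $\operatorname{supp}\mu_{F_\delta}$ is the minimal set that is closed in $\hat{\mathbb C}$, forward invariant under $F_\delta$ and contains a point of $\mathbb C$: it has these three properties and is contained in every set that has them. -/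

import Mathlib

open scoped Polynomial OnePoint ENNReal

/-- The Borel σ-algebra of the Riemann sphere `ℂ ∪ {∞}`. -/
noncomputable instance instMeasurableSpaceRiemannSphere : MeasurableSpace (OnePoint ℂ) := borel (OnePoint ℂ)

instance instBorelSpaceRiemannSphere : BorelSpace (OnePoint ℂ) := ⟨rfl⟩

noncomputable section

namespace HolCorr

/-- The Riemann sphere. -/
abbrev Sphere : Type := OnePoint ℂ

/-! Polynomials in the two variables `z` and `w` are elements of `MvPolynomial (Fin 2) ℂ`;
variable `0` is `z` and variable `1` is `w`. -/

/-- The family `R_δ(z, w) = R₀(w) + δ P(z, w)`. -/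
def perturbed (R₀ : ℂ[X]) (P : MvPolynomial (Fin 2) ℂ) (δ : ℂ) : MvPolynomial (Fin 2) ℂ :=
  Polynomial.aeval (MvPolynomial.X 1) R₀ + MvPolynomial.C δ * P

/-- The closure in `Ĉ × Ĉ` of the affine curve `{(z, w) ∈ ℂ² : R(z, w) = 0}`. -/
def curve (R : MvPolynomial (Fin 2) ℂ) : Set (Sphere × Sphere) :=
  closure {p | ∃ z w : ℂ, MvPolynomial.eval ![z, w] R = 0 ∧ p = ((z : Sphere), (w : Sphere))}

/-- The multivalued map `F : z → w` defined by `R(z, w) = 0`, as a set-valued map: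
`F(z)` is the set of all `w` such that `(z, w)` lies on the compactified curve. -/
def image (R : MvPolynomial (Fin 2) ℂ) (z : Sphere) : Set Sphere := {w | (z, w) ∈ curve R}

/-- A set `S` is forward invariant under the correspondence defined by `R` if `F(S) ⊆ S`. -/
def ForwardInvariant (R : MvPolynomial (Fin 2) ℂ) (S : Set Sphere) : Prop :=
  (⋃ z ∈ S, image R z) ⊆ S

/-- `R(z, w)` as a polynomial in `z` (the outer variable) whose coefficients are
polynomials in `w`. -/
def asPolyInZ (R : MvPolynomial (Fin 2) ℂ) : ℂ[X][X] :=
  MvPolynomial.aeval ![(Polynomial.X : ℂ[X][X]), Polynomial.C Polynomial.X] R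

/-- The polynomial in `w` that cuts out the points of the curve over a given `z`.
For `z ∈ ℂ` it is `R(z, ·)`. For `z = ∞` it is the coefficient of the highest power of `z`
in `R`, that is, the value at `t = 0` of `t ^ e * R(1 / t, w)`, where `e` is the degree
of `R` in `z`. -/
def slice (R : MvPolynomial (Fin 2) ℂ) (z : Sphere) : ℂ[X] :=
  z.elim (asPolyInZ R).leadingCoeff (fun z₀ => (asPolyInZ R).eval (Polynomial.C z₀))

/-- The points of `F(z)` counted with multiplicity (the intersection multiplicity of the
compactified curve with `{z} × Ĉ`), for a curve that does not contain `{z} × Ĉ`: the zeros of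
the slice in `ℂ`, and the point `∞` with multiplicity the drop of the degree of the slice
below the degree of `R` in `w`. If `R` does not depend on `z`, this is the multiset of the
zeros of `R`, for every `z`. -/
def fiber (R : MvPolynomial (Fin 2) ℂ) (z : Sphere) : Multiset Sphere :=
  (slice R z).roots.map (fun w => (w : Sphere)) +
    Multiset.replicate (R.degreeOf 1 - (slice R z).natDegree) (∞ : Sphere)

/-- The `m`-th iterate of a multivalued map, with multiplicities. -/
def iter (F : Sphere → Multiset Sphere) : ℕ → Sphere → Multiset Sphere
  | 0, z => {z}
  | m + 1, z => (iter F m z).bind F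

/-- The push-forward `F_* μ` of a measure under a multivalued map with multiplicities:
`F_* δ_a` is the sum of the Dirac measures at the points of `F(a)`, counted with multiplicity,
and `F_* μ = ∫ F_* δ_a dμ(a)`, so that
`⟨F_* μ, φ⟩ = ∫ ∑_{x ∈ F(a)} φ(x) dμ(a)`. -/
def pushforward (F : Sphere → Multiset Sphere) (μ : MeasureTheory.Measure Sphere) :
    MeasureTheory.Measure Sphere :=
  μ.bind fun a => ((F a).map MeasureTheory.Measure.dirac).sum

/-- Weak* convergence of a sequence of measures on the (compact) sphere: convergence of the
integrals of all continuous functions. -/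
def WeakStarTendsto (ν : ℕ → MeasureTheory.Measure Sphere) (μ : MeasureTheory.Measure Sphere) :
    Prop :=
  ∀ φ : C(Sphere, ℂ),
    Filter.Tendsto (fun m => ∫ x, φ x ∂(ν m)) Filter.atTop (nhds (∫ x, φ x ∂μ))

end HolCorr

end

/-! Near the zeros of `R₀` the relation `R₀(w) + δ P(z, w) = 0` can be solved for `w` when `δ` is
small: over a large disc the correspondence splits into `d` branches, one near each zero, and they
are `1/2`-Lipschitz because `R₀` is expanding near its simple zeros while `δ P` has a small
Lipschitz constant. For such an iterated function system on a compact metric space the averages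
of a continuous function over the `m`-th iterates converge uniformly to a constant, so there is a
stationary measure and it attracts all orbits starting in the disc. Outside the disc every image
point has at most half the modulus, because `P` has total degree at most `d`; hence after finitely
many steps all orbits are in the disc, and the stationary measure is the limit for every starting
point `a ∈ ℂ`. Starting in a closed forward invariant set, the limit is supported in that set, which
gives minimality. -/

open Filter Topology MeasureTheory

namespace HolCorr

section Transfer

variable {X E ι : Type*} [Fintype ι]

/-- The transfer operator `φ ↦ (card ι)⁻¹ ∑ i, φ ∘ f i` of an iterated function system with equal
weights. It is a linear endomorphism, so that its iterates are powers. -/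
noncomputable def transfer [AddCommGroup E] [Module ℝ E] (f : ι → X → X) :
    Module.End ℝ (X → E) :=
  (Fintype.card ι : ℝ)⁻¹ • ∑ i, LinearMap.funLeft ℝ E (f i)

theorem transfer_apply [AddCommGroup E] [Module ℝ E] (f : ι → X → X) (φ : X → E) (x : X) :
    transfer f φ x = (Fintype.card ι : ℝ)⁻¹ • ∑ i, φ (f i x) := by
  simp [transfer, LinearMap.funLeft_apply]

theorem transfer_pow_succ_apply [AddCommGroup E] [Module ℝ E] (f : ι → X → X) (m : ℕ) (φ : X → E)
    (x : X) : (transfer f ^ (m + 1)) φ x =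
      (Fintype.card ι : ℝ)⁻¹ • ∑ i, (transfer f ^ m) φ (f i x) := by
  rw [pow_succ', Module.End.mul_apply, transfer_apply]

theorem average_mem [Nonempty ι] [AddCommGroup E] [Module ℝ E] {C : Set E} (hC : Convex ℝ C)
    {a : ι → E} (ha : ∀ i, a i ∈ C) : (Fintype.card ι : ℝ)⁻¹ • ∑ i, a i ∈ C := by
  rw [Finset.smul_sum]
  exact hC.sum_mem (fun _ _ => by positivity) (by simp) fun i _ => ha i

theorem transfer_pow_mem [Nonempty ι] [AddCommGroup E] [Module ℝ E] {C : Set E} (hC : Convex ℝ C)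
    (f : ι → X → X) {φ : X → E} (hφ : ∀ y, φ y ∈ C) (m : ℕ) (x : X) :
    (transfer f ^ m) φ x ∈ C := by
  induction m generalizing x with
  | zero => exact hφ x
  | succ m ih =>
    rw [transfer_pow_succ_apply]
    exact average_mem hC fun i => ih (f i x)

variable [NormedAddCommGroup E] [NormedSpace ℝ E] {f : ι → X → X} {φ : X → E}

theorem continuous_transfer [TopologicalSpace X] (hf : ∀ i, Continuous (f i)) (hφ : Continuous φ) :
    Continuous (transfer f φ) := by
  simp only [funext (transfer_apply f φ)]
  exact (continuous_finsetSum _ fun i _ => hφ.comp (hf i)).const_smul _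

theorem dist_transfer_pow_le [PseudoMetricSpace X] [Nonempty ι] {K : NNReal}
    (hf : ∀ i, LipschitzWith K (f i)) {s e : ℝ} (h : ∀ x y, dist x y ≤ s → dist (φ x) (φ y) ≤ e)
    (m : ℕ) (x y : X) (hxy : K ^ m * dist x y ≤ s) :
    dist ((transfer f ^ m) φ x) ((transfer f ^ m) φ y) ≤ e := by
  induction m generalizing x y with
  | zero => exact h x y (by simpa using hxy)
  | succ m ih =>
    rw [transfer_pow_succ_apply, transfer_pow_succ_apply, dist_eq_norm, ← smul_sub,
      ← Finset.sum_sub_distrib, ← mem_closedBall_zero_iff]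
    refine average_mem (convex_closedBall 0 e) fun i => ?_
    rw [mem_closedBall_zero_iff, ← dist_eq_norm]
    refine ih _ _ (le_trans ?_ hxy)
    calc K ^ m * dist (f i x) (f i y) ≤ K ^ m * (K * dist x y) := by
          gcongr
          exact (hf i).dist_le_mul x y
      _ = K ^ (m + 1) * dist x y := by ring

variable [PseudoMetricSpace X] [CompactSpace X] [Nonempty ι] {K : NNReal}

theorem eventually_dist_transfer_pow_le (hK : K < 1) (hf : ∀ i, LipschitzWith K (f i))
    (hφ : Continuous φ) {e : ℝ} (he : 0 < e) :
    ∀ᶠ m in atTop, ∀ x y, dist ((transfer f ^ m) φ x) ((transfer f ^ m) φ y) ≤ e := by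
  obtain ⟨s, hs, h⟩ := Metric.uniformContinuous_iff.1
    (CompactSpace.uniformContinuous_of_continuous hφ) e he
  have hdiam : Tendsto (fun m : ℕ => (K : ℝ) ^ m * Metric.diam (Set.univ : Set X)) atTop (𝓝 0) := by
    simpa using (tendsto_pow_atTop_nhds_zero_of_lt_one K.2 (by exact_mod_cast hK)).mul_const
      (Metric.diam (Set.univ : Set X))
  filter_upwards [hdiam.eventually (ge_mem_nhds (half_pos hs))] with m hm x y
  refine dist_transfer_pow_le hf (fun x y hxy => (h (by linarith)).le) m x y (le_trans ?_ hm)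
  gcongr
  exact Metric.dist_le_diam_of_mem isCompact_univ.isBounded trivial trivial

theorem exists_tendsto_transfer_pow [CompleteSpace E] (hK : K < 1)
    (hf : ∀ i, LipschitzWith K (f i)) (hφ : Continuous φ) (x : X) :
    ∃ l, Tendsto (fun m => (transfer f ^ m) φ x) atTop (𝓝 l) := by
  refine cauchySeq_tendsto_of_complete (Metric.cauchySeq_iff'.2 fun e he => ?_)
  obtain ⟨N, hN⟩ := (eventually_dist_transfer_pow_le hK hf hφ (half_pos he)).exists
  refine ⟨N, fun n hn => ?_⟩
  obtain ⟨k, rfl⟩ := Nat.exists_eq_add_of_le' hn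
  rw [pow_add, Module.End.mul_apply]
  exact (transfer_pow_mem (convex_closedBall _ _) f (fun y => hN y x) k x).trans_lt
    (half_lt_self he)

end Transfer

section Stationary

variable {X E ι : Type*} [Fintype ι] [MeasurableSpace X] {f : ι → X → X} {μ : Measure X}

/-- A measure is stationary for an iterated function system with equal weights if it is the average
of its images. Both sides are multiplied by the number of maps, as in `F_* μ = d μ`. -/
def IsStationary (f : ι → X → X) (μ : Measure X) : Prop :=
  ∑ i, μ.map (f i) = (Fintype.card ι : ℝ≥0∞) • μ

section Integral

variable [NormedAddCommGroup E] {φ : X → E}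

theorem IsStationary.integrable_map (hμ : IsStationary f μ) (hφ : Integrable φ μ) (i : ι) :
    Integrable φ (μ.map (f i)) := by
  have h : Integrable φ (∑ i, μ.map (f i)) := by
    rw [hμ]
    exact hφ.smul_measure (ENNReal.natCast_ne_top _)
  exact integrable_finsetSum_measure.1 h i (Finset.mem_univ i)

variable [NormedSpace ℝ E]

theorem IsStationary.integrable_transfer (hμ : IsStationary f μ) (hf : ∀ i, Measurable (f i))
    (hφ : Integrable φ μ) : Integrable (transfer f φ) μ := by
  simp only [funext (transfer_apply f φ)]
  exact (integrable_finsetSum _ fun i _ => (hμ.integrable_map hφ i).comp_measurable (hf i)).smul _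

theorem IsStationary.integral_transfer [Nonempty ι] (hμ : IsStationary f μ)
    (hf : ∀ i, Measurable (f i)) (hφ : Integrable φ μ) :
    ∫ x, transfer f φ x ∂μ = ∫ x, φ x ∂μ := by
  have hφf := hμ.integrable_map hφ
  have hcard : (Fintype.card ι : ℝ) ≠ 0 := by exact_mod_cast Fintype.card_ne_zero
  calc ∫ x, transfer f φ x ∂μ
      = (Fintype.card ι : ℝ)⁻¹ • ∑ i, ∫ x, φ (f i x) ∂μ := by
        simp only [transfer_apply]
        rw [integral_smul]
        exact congrArg _ (integral_finsetSum _ fun i _ => (hφf i).comp_measurable (hf i))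
    _ = (Fintype.card ι : ℝ)⁻¹ • ∫ x, φ x ∂(∑ i, μ.map (f i)) := by
        rw [integral_finsetSum_measure fun i _ => hφf i]
        simp only [integral_map (hf _).aemeasurable (hφf _).aestronglyMeasurable]
    _ = ∫ x, φ x ∂μ := by
        rw [hμ, integral_smul_measure, ENNReal.toReal_natCast, inv_smul_smul₀ hcard]

theorem IsStationary.integrable_and_integral_transfer_pow [Nonempty ι] (hμ : IsStationary f μ)
    (hf : ∀ i, Measurable (f i)) (hφ : Integrable φ μ) (m : ℕ) :
    Integrable ((transfer f ^ m) φ) μ ∧ ∫ x, (transfer f ^ m) φ x ∂μ = ∫ x, φ x ∂μ := by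
  induction m with
  | zero => exact ⟨hφ, rfl⟩
  | succ m ih =>
    rw [pow_succ', Module.End.mul_apply]
    exact ⟨hμ.integrable_transfer hf ih.1, (hμ.integral_transfer hf ih.1).trans ih.2⟩

end Integral

variable [PseudoMetricSpace X] [CompactSpace X] [BorelSpace X]

theorem IsStationary.tendsto_transfer_pow [NormedAddCommGroup E] [NormedSpace ℝ E]
    [CompleteSpace E] [Nonempty ι] [IsProbabilityMeasure μ] (hμ : IsStationary f μ) {K : NNReal}
    (hK : K < 1) (hf : ∀ i, LipschitzWith K (f i)) {φ : X → E} (hφ : Continuous φ) (x : X) :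
    Tendsto (fun m => (transfer f ^ m) φ x) atTop (𝓝 (∫ y, φ y ∂μ)) := by
  have hφi : Integrable φ μ := hφ.integrable_of_hasCompactSupport (.of_compactSpace φ)
  refine Metric.nhds_basis_closedBall.tendsto_right_iff.2 fun e he => ?_
  filter_upwards [eventually_dist_transfer_pow_le hK hf hφ he] with m hm
  obtain ⟨hi, hint⟩ := hμ.integrable_and_integral_transfer_pow
    (fun i => (hf i).continuous.measurable) hφi m
  rw [Metric.mem_closedBall, dist_comm, ← Metric.mem_closedBall, ← hint]
  exact (convex_closedBall _ e).integral_mem Metric.isClosed_closedBall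
    (ae_of_all _ fun y => hm y x) hi

theorem isStationary_of_tendsto [Nonempty ι] [IsFiniteMeasure μ] (hf : ∀ i, Continuous (f i))
    (x : X) (h : ∀ φ : X → ℝ, Continuous φ →
      Tendsto (fun m => (transfer f ^ m) φ x) atTop (𝓝 (∫ y, φ y ∂μ))) :
    IsStationary f μ := by
  have : IsFiniteMeasure ((Fintype.card ι : ℝ≥0∞) • μ) :=
    Measure.smul_finite μ (ENNReal.natCast_ne_top _)
  refine ext_of_forall_integral_eq_of_IsFiniteMeasure fun φ => ?_
  have hcard : (Fintype.card ι : ℝ) ≠ 0 := by exact_mod_cast Fintype.card_ne_zero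
  have hφf : ∀ i, Integrable (fun y => φ (f i y)) μ := fun i =>
    (φ.continuous.comp (hf i)).integrable_of_hasCompactSupport (.of_compactSpace _)
  have hinv : ∫ y, transfer f φ y ∂μ = ∫ y, φ y ∂μ := by
    refine tendsto_nhds_unique (h _ (continuous_transfer hf φ.continuous)) ?_
    simp only [← Module.End.mul_apply, ← pow_succ]
    exact (h φ φ.continuous).comp (tendsto_add_atTop_nat 1)
  simp only [transfer_apply] at hinv
  rw [integral_smul, integral_finsetSum _ fun i _ => hφf i, inv_smul_eq_iff₀ hcard] at hinv
  rw [integral_finsetSum_measure fun i _ => φ.integrable _, integral_smul_measure,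
    ENNReal.toReal_natCast, ← hinv]
  simp only [integral_map (hf _).aemeasurable φ.continuous.aestronglyMeasurable]

end Stationary

theorem exists_isProbabilityMeasure_tendsto {X : Type*} [TopologicalSpace X] [CompactSpace X]
    [T2Space X] [MeasurableSpace X] [BorelSpace X] (A : ℕ → (X → ℝ) →ₗ[ℝ] ℝ) (hone : ∀ m, A m 1 = 1)
    (hnonneg : ∀ m φ, (∀ x, 0 ≤ φ x) → 0 ≤ A m φ)
    (hconv : ∀ φ, Continuous φ → ∃ l, Tendsto (fun m => A m φ) atTop (𝓝 l)) :
    ∃ μ : Measure X, IsProbabilityMeasure μ ∧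
      ∀ φ : X → ℝ, Continuous φ → Tendsto (fun m => A m φ) atTop (𝓝 (∫ x, φ x ∂μ)) := by
  choose Λ hΛ using fun φ : CompactlySupportedContinuousMap X ℝ => hconv φ φ.continuous
  let L : PositiveLinearMap ℝ (CompactlySupportedContinuousMap X ℝ) ℝ := PositiveLinearMap.mk₀
    { toFun := Λ
      map_add' φ ψ := by
        refine tendsto_nhds_unique (hΛ (φ + ψ)) (((hΛ φ).add (hΛ ψ)).congr fun m => ?_)
        exact ((A m).map_add φ ψ).symm
      map_smul' c φ := by
        refine tendsto_nhds_unique (hΛ (c • φ)) (((hΛ φ).const_smul c).congr fun m => ?_)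
        exact ((A m).map_smul c φ).symm }
    fun φ hφ => ge_of_tendsto' (hΛ φ) fun m => hnonneg m φ fun x => hφ x
  have hlim : ∀ φ : X → ℝ, Continuous φ →
      Tendsto (fun m => A m φ) atTop (𝓝 (∫ x, φ x ∂(RealRMK.rieszMeasure L))) := fun φ hφ => by
    have h := hΛ (CompactlySupportedContinuousMap.continuousMapEquiv ⟨φ, hφ⟩)
    rwa [show Λ _ = L _ from rfl, ← RealRMK.integral_rieszMeasure] at h
  refine ⟨RealRMK.rieszMeasure L, ⟨?_⟩, hlim⟩
  have hmass := tendsto_nhds_unique (hlim 1 continuous_one)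
    (tendsto_const_nhds.congr fun m => (hone m).symm)
  simpa [measureReal_def, ENNReal.toReal_eq_one_iff] using hmass

theorem exists_isStationary {X ι : Type*} [MetricSpace X] [CompactSpace X] [Nonempty X]
    [MeasurableSpace X] [BorelSpace X] [Fintype ι] [Nonempty ι] {f : ι → X → X} {K : NNReal}
    (hK : K < 1) (hf : ∀ i, LipschitzWith K (f i)) :
    ∃ μ : Measure X, IsProbabilityMeasure μ ∧ IsStationary f μ := by
  let x : X := Classical.arbitrary X
  let A : ℕ → (X → ℝ) →ₗ[ℝ] ℝ := fun m => LinearMap.proj x ∘ₗ transfer f ^ m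
  obtain ⟨μ, hμ, hlim⟩ := exists_isProbabilityMeasure_tendsto A
    (fun m => transfer_pow_mem (convex_singleton 1) f (fun _ => rfl) m x)
    (fun m φ hφ => transfer_pow_mem (convex_Ici (0 : ℝ)) f hφ m x)
    (fun φ hφ => exists_tendsto_transfer_pow hK hf hφ x)
  exact ⟨μ, hμ, isStationary_of_tendsto (fun i => (hf i).continuous) x hlim⟩

section Support

variable {X Y ι : Type*} [TopologicalSpace X] [MeasurableSpace X] [BorelSpace X]
  {μ : Measure X}

theorem mapsTo_support_map [TopologicalSpace Y] [MeasurableSpace Y] [BorelSpace Y] {f : X → Y}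
    (hf : Continuous f) (μ : Measure X) : Set.MapsTo f μ.support (μ.map f).support := by
  intro x hx
  rw [Measure.support_eq_forall_isOpen] at hx ⊢
  intro U hxU hU
  rw [Measure.map_apply hf.measurable hU.measurableSet]
  exact hx _ hxU (hU.preimage hf)

theorem support_map_of_isClosedMap [TopologicalSpace Y] [MeasurableSpace Y] [BorelSpace Y]
    [HereditarilyLindelofSpace X] {f : X → Y} (hf : Continuous f) (hf' : IsClosedMap f)
    (μ : Measure X) : (μ.map f).support = f '' μ.support := by
  refine Set.Subset.antisymm ?_ (mapsTo_support_map hf μ).image_subset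
  have hclosed := hf' _ (Measure.isClosed_support (μ := μ))
  refine Measure.support_subset_of_isClosed hclosed ?_
  rw [mem_ae_map_iff hf.aemeasurable hclosed.measurableSet]
  exact mem_of_superset Measure.support_mem_ae (Set.subset_preimage_image f _)

variable [Fintype ι] {f : ι → X → X}

theorem IsStationary.mapsTo_support (hμ : IsStationary f μ) (hf : ∀ i, Continuous (f i)) (i : ι) :
    Set.MapsTo (f i) μ.support μ.support := by
  refine (mapsTo_support_map (hf i) μ).mono_right (Measure.AbsolutelyContinuous.support_mono ?_)
  refine Measure.absolutelyContinuous_of_le_smul (c := Fintype.card ι) ?_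
  rw [← hμ]
  exact Finset.single_le_sum (fun _ _ => Measure.zero_le _) (Finset.mem_univ i)

theorem IsStationary.support_subset_iUnion_range [CompactSpace X] [T2Space X] [Nonempty ι]
    (hμ : IsStationary f μ) (hf : ∀ i, Continuous (f i)) :
    μ.support ⊆ ⋃ i, Set.range (f i) := by
  have hclosed : IsClosed (⋃ i, Set.range (f i)) :=
    isClosed_iUnion_of_finite fun i => (isCompact_range (hf i)).isClosed
  refine Measure.support_subset_of_isClosed hclosed ?_
  have h : ((Fintype.card ι : ℝ≥0∞) • μ) (⋃ i, Set.range (f i))ᶜ = 0 := by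
    rw [← hμ, Measure.finsetSum_apply]
    refine Finset.sum_eq_zero fun i _ => ?_
    rw [← mem_ae_iff, mem_ae_map_iff (hf i).aemeasurable hclosed.measurableSet]
    exact univ_mem' fun x => Set.mem_iUnion.2 ⟨i, x, rfl⟩
  rw [Measure.smul_apply, smul_eq_mul, mul_eq_zero] at h
  exact h.resolve_left (Nat.cast_ne_zero.2 Fintype.card_ne_zero)

end Support

section DiracSum

variable {Y E : Type*} [MeasurableSpace Y] [MeasurableSingletonClass Y]

theorem ae_multiset_sum_dirac {s : Multiset Y} {p : Y → Prop} (h : ∀ x ∈ s, p x) :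
    ∀ᵐ x ∂(s.map Measure.dirac).sum, p x := by
  induction s using Multiset.induction with
  | empty => simp
  | cons a s ih =>
    rw [Multiset.map_cons, Multiset.sum_cons, ae_add_measure_iff]
    exact ⟨by simpa [ae_dirac_eq] using h a (Multiset.mem_cons_self a s),
      ih fun x hx => h x (Multiset.mem_cons_of_mem hx)⟩

theorem integrable_multiset_sum_dirac [NormedAddCommGroup E] (s : Multiset Y) (φ : Y → E) :
    Integrable φ (s.map Measure.dirac).sum := by
  induction s using Multiset.induction with
  | empty => simp
  | cons a s ih =>
    rw [Multiset.map_cons, Multiset.sum_cons]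
    exact (integrable_dirac (by simp)).add_measure ih

theorem integral_multiset_sum_dirac [NormedAddCommGroup E] [NormedSpace ℝ E] [CompleteSpace E]
    (s : Multiset Y) (φ : Y → E) : ∫ x, φ x ∂(s.map Measure.dirac).sum = (s.map φ).sum := by
  induction s using Multiset.induction with
  | empty => simp
  | cons a s ih =>
    simp only [Multiset.map_cons, Multiset.sum_cons]
    rw [integral_add_measure (integrable_dirac (by simp)) (integrable_multiset_sum_dirac s φ),
      integral_dirac, ih]

end DiracSum

theorem bind_finsetSum {X Y ι : Type*} [MeasurableSpace X] [MeasurableSpace Y] {s : Finset ι}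
    (μ : Measure X) {κ : ι → X → Measure Y} (hκ : ∀ i ∈ s, Measurable (κ i)) :
    (μ.bind fun x => ∑ i ∈ s, κ i x) = ∑ i ∈ s, μ.bind (κ i) := by
  ext t ht
  rw [Measure.bind_apply ht (Finset.measurable_sum s hκ).aemeasurable, Measure.finsetSum_apply]
  simp only [Measure.finsetSum_apply]
  refine (lintegral_finsetSum s fun i hi => (Measure.measurable_coe ht).comp (hκ i hi)).trans ?_
  exact Finset.sum_congr rfl fun i hi => (Measure.bind_apply ht (hκ i hi).aemeasurable).symm

section FiberAverage

variable {E : Type*} {F : Sphere → Multiset Sphere}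

/-- The average `a ↦ d⁻¹ ∑_{x ∈ F(a)} φ x` of a function over the fibres of a `d`-valued map: the
dual of `μ ↦ d⁻¹ F_* μ`. -/
noncomputable def fiberAverage [AddCommGroup E] [Module ℝ E] (F : Sphere → Multiset Sphere) (d : ℕ)
    (φ : Sphere → E) (a : Sphere) : E :=
  (d : ℝ)⁻¹ • ((F a).map φ).sum

theorem inv_pow_smul_sum_map_iter [AddCommGroup E] [Module ℝ E] (F : Sphere → Multiset Sphere)
    (d m : ℕ) (φ : Sphere → E) (a : Sphere) :
    ((d : ℝ) ^ m)⁻¹ • ((iter F m a).map φ).sum = (fiberAverage F d)^[m] φ a := by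
  induction m generalizing φ with
  | zero => simp [iter]
  | succ m ih =>
    rw [Function.iterate_succ_apply, ← ih, iter, Multiset.map_bind, Multiset.sum_bind, pow_succ,
      mul_inv, mul_smul, Multiset.smul_sum, Multiset.map_map]
    rfl

theorem pushforward_dirac (F : Sphere → Multiset Sphere) (a : Sphere) :
    pushforward F (Measure.dirac a) = ((F a).map Measure.dirac).sum := by
  have h : (fun x => ((F x).map Measure.dirac).sum) =ᵐ[Measure.dirac a]
      fun _ => ((F a).map Measure.dirac).sum := by
    rw [EventuallyEq, ae_dirac_eq]
    exact rfl
  rw [pushforward, Measure.bind_congr_right h, Measure.dirac_bind measurable_const]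

theorem integral_pushforward_iter_dirac [NormedAddCommGroup E] [NormedSpace ℝ E] [CompleteSpace E]
    (F : Sphere → Multiset Sphere) (d m : ℕ) (φ : Sphere → E) (a : Sphere) :
    ∫ x, φ x ∂(((d : ℝ≥0∞) ^ m)⁻¹ • pushforward (iter F m) (Measure.dirac a)) =
      (fiberAverage F d)^[m] φ a := by
  rw [integral_smul_measure, pushforward_dirac, integral_multiset_sum_dirac,
    ← inv_pow_smul_sum_map_iter]
  simp

theorem tendsto_fiberAverage_iterate [NormedAddCommGroup E] [NormedSpace ℝ E] {d : ℕ} (hd : d ≠ 0)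
    {φ : Sphere → E} {a : Sphere} {c : E} (hcard : (F a).card = d)
    (h : ∀ x ∈ F a, Tendsto (fun m => (fiberAverage F d)^[m] φ x) atTop (𝓝 c)) :
    Tendsto (fun m => (fiberAverage F d)^[m] φ a) atTop (𝓝 c) := by
  rw [← tendsto_add_atTop_iff_nat 1]
  simp only [Function.iterate_succ_apply']
  have hsum := (tendsto_multiset_sum (F a) h).const_smul (d : ℝ)⁻¹
  rwa [Multiset.map_const', Multiset.sum_replicate, hcard, ← Nat.cast_smul_eq_nsmul ℝ,
    inv_smul_smul₀ (Nat.cast_ne_zero.2 hd)] at hsum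

theorem WeakStarTendsto.support_subset {ν : ℕ → Measure Sphere} {μ : Measure Sphere}
    [IsFiniteMeasure μ] (h : WeakStarTendsto ν μ) {S : Set Sphere} (hS : IsClosed S)
    (hν : ∀ m, ∀ᵐ x ∂ν m, x ∈ S) : μ.support ⊆ S := by
  intro x hx
  by_contra hxS
  obtain ⟨φ, hφS, hφx, hφ⟩ := exists_continuous_zero_one_of_isClosed hS isClosed_singleton
    (Set.disjoint_singleton_right.2 hxS)
  have hlim := h ⟨fun y => (φ y : ℂ), Complex.continuous_ofReal.comp φ.continuous⟩
  have hzero : ∫ y, φ y ∂μ = 0 := by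
    refine Complex.ofReal_eq_zero.1 (integral_complex_ofReal.symm.trans ?_)
    refine tendsto_nhds_unique hlim (tendsto_const_nhds.congr fun m => (?_ : (0 : ℂ) = _))
    refine (integral_eq_zero_of_ae ((hν m).mono fun y hy => ?_)).symm
    simpa using hφS hy
  have hae := (integral_eq_zero_iff_of_nonneg (fun y => (hφ y).1)
    (φ.continuous.integrable_of_hasCompactSupport (.of_compactSpace φ))).1 hzero
  refine ((Measure.mem_support_iff_forall x).1 hx {y | φ y ≠ 0}
    ((isOpen_ne_fun φ.continuous continuous_const).mem_nhds ?_)).ne' hae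
  rw [Set.mem_ofPred_eq, hφx (Set.mem_singleton x)]
  exact one_ne_zero

end FiberAverage

section BranchSystem

variable {X E ι : Type*} [Fintype ι] {F : Sphere → Multiset Sphere} {j : X → Sphere}
  {g : ι → X → X}

/-- Over the image of `j`, the multivalued map `F` is the union of the single-valued branches `g i`,
counted with multiplicity. -/
def IsBranchSystem (F : Sphere → Multiset Sphere) (j : X → Sphere) (g : ι → X → X) : Prop :=
  ∀ x, F (j x) = Finset.univ.val.map fun i => j (g i x)

theorem IsBranchSystem.fiberAverage_iterate [AddCommGroup E] [Module ℝ E]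
    (hF : IsBranchSystem F j g) (m : ℕ) (φ : Sphere → E) (x : X) :
    (fiberAverage F (Fintype.card ι))^[m] φ (j x) = (transfer g ^ m) (φ ∘ j) x := by
  have h : Function.Semiconj (fun φ : Sphere → E => φ ∘ j) (fiberAverage F (Fintype.card ι))
      (transfer g) := fun φ => funext fun x => by
    simp only [transfer_apply, Function.comp_apply, fiberAverage, hF x, Multiset.map_map]
    rfl
  rw [Module.End.pow_apply]
  exact congrFun (h.iterate_right m φ) x

theorem IsBranchSystem.pushforward_map [MeasurableSpace X] (hF : IsBranchSystem F j g)
    (hj : MeasurableEmbedding j) (hg : ∀ i, Measurable (g i)) (μ : Measure X) :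
    pushforward F (μ.map j) = (∑ i, μ.map (g i)).map j := by
  choose h hh hhj using fun i => hj.exists_measurable_extend (hj.measurable.comp (hg i))
    fun _ => ⟨(∞ : Sphere)⟩
  have hhg : ∀ i x, h i (j x) = j (g i x) := fun i x => congrFun (hhj i) x
  have hae : (fun y => ((F y).map Measure.dirac).sum) =ᵐ[μ.map j]
      fun y => ∑ i, Measure.dirac (h i y) := by
    rw [EventuallyEq, hj.ae_map_iff]
    refine Eventually.of_forall fun x => ?_
    rw [hF, Multiset.map_map]
    exact Finset.sum_congr rfl fun i _ => congrArg Measure.dirac (hhg i x).symm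
  calc pushforward F (μ.map j) = (μ.map j).bind fun y => ∑ i, Measure.dirac (h i y) := by
        rw [pushforward, Measure.bind_congr_right hae]
    _ = ∑ i, (μ.map j).map (h i) := by
        refine (bind_finsetSum _ fun i _ => Measure.measurable_dirac.comp (hh i)).trans ?_
        exact Finset.sum_congr rfl fun i _ => Measure.bind_dirac_eq_map _ (hh i)
    _ = ∑ i, (μ.map (g i)).map j := Finset.sum_congr rfl fun i _ => by
        rw [Measure.map_map (hh i) hj.measurable, Measure.map_map hj.measurable (hg i), hhj]
    _ = (∑ i, μ.map (g i)).map j := (Measure.map_finset_sum' hj.measurable.aemeasurable).symm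

theorem IsStationary.pushforward_map [MeasurableSpace X] {μ : Measure X} (hμ : IsStationary g μ)
    (hF : IsBranchSystem F j g) (hj : MeasurableEmbedding j) (hg : ∀ i, Measurable (g i)) :
    pushforward F (μ.map j) = (Fintype.card ι : ℝ≥0∞) • μ.map j := by
  rw [hF.pushforward_map hj hg, hμ, Measure.map_smul]

end BranchSystem

section Slice

theorem slice_coe_eq_aeval (R : MvPolynomial (Fin 2) ℂ) (z : ℂ) :
    slice R z = MvPolynomial.aeval ![Polynomial.C z, Polynomial.X] R := by
  change (asPolyInZ R).eval (Polynomial.C z) = _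
  unfold asPolyInZ
  induction R using MvPolynomial.induction_on with
  | C a => simp [Polynomial.algebraMap_apply]
  | add p q hp hq => simp only [map_add, Polynomial.eval_add, hp, hq]
  | mul_X p i hp =>
    rw [map_mul, Polynomial.eval_mul, hp, map_mul]
    fin_cases i <;> simp

theorem eval_slice (R : MvPolynomial (Fin 2) ℂ) (z w : ℂ) :
    (slice R z).eval w = MvPolynomial.eval ![z, w] R := by
  rw [slice_coe_eq_aeval]
  induction R using MvPolynomial.induction_on with
  | C a => simp
  | add p q hp hq => simp only [map_add, Polynomial.eval_add, hp, hq]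
  | mul_X p i hp =>
    rw [map_mul, Polynomial.eval_mul, hp, map_mul]
    fin_cases i <;> simp

theorem slice_perturbed (R₀ : ℂ[X]) (P : MvPolynomial (Fin 2) ℂ) (δ z : ℂ) :
    slice (perturbed R₀ P δ) z = R₀ + Polynomial.C δ * slice P z := by
  simp only [slice_coe_eq_aeval, perturbed, map_add, map_mul, ← Polynomial.aeval_algHom_apply,
    MvPolynomial.aeval_X]
  simp

theorem eval_perturbed (R₀ : ℂ[X]) (P : MvPolynomial (Fin 2) ℂ) (δ z w : ℂ) :
    MvPolynomial.eval ![z, w] (perturbed R₀ P δ) =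
      R₀.eval w + δ * MvPolynomial.eval ![z, w] P := by
  rw [← eval_slice, slice_perturbed, Polynomial.eval_add, Polynomial.eval_mul, Polynomial.eval_C,
    eval_slice]

theorem slice_eq_sum (P : MvPolynomial (Fin 2) ℂ) (z : ℂ) :
    slice P z = ∑ m ∈ P.support,
      Polynomial.C (P.coeff m * z ^ m 0) * Polynomial.X ^ m 1 := by
  rw [slice_coe_eq_aeval, MvPolynomial.aeval_def, MvPolynomial.eval₂_eq']
  refine Finset.sum_congr rfl fun m _ => ?_
  simp [Fin.prod_univ_two, mul_assoc]

variable {P : MvPolynomial (Fin 2) ℂ} {d : ℕ}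

theorem add_le_of_mem_support (hP : P.totalDegree ≤ d) {m : Fin 2 →₀ ℕ} (hm : m ∈ P.support) :
    m 0 + m 1 ≤ d := by
  have h := (MvPolynomial.le_totalDegree hm).trans hP
  rwa [Finsupp.sum_fintype _ _ (fun _ => rfl), Fin.sum_univ_two] at h

theorem natDegree_slice_le (hP : P.totalDegree ≤ d) (z : ℂ) : (slice P z).natDegree ≤ d := by
  rw [slice_eq_sum]
  refine Polynomial.natDegree_sum_le_of_forall_le _ _ fun m hm => ?_
  refine (Polynomial.natDegree_C_mul_X_pow_le _ _).trans ?_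
  have := add_le_of_mem_support hP hm
  lia

theorem coeff_slice (hP : P.totalDegree ≤ d) (z : ℂ) :
    (slice P z).coeff d = P.coeff (Finsupp.single 1 d) := by
  rw [slice_eq_sum, Polynomial.finsetSum_coeff]
  simp only [Polynomial.coeff_C_mul_X_pow]
  rw [Finset.sum_eq_single (Finsupp.single 1 d)]
  · simp
  · intro m hm hne
    refine if_neg fun hd => hne ?_
    have := add_le_of_mem_support hP hm
    ext i
    fin_cases i
    · simp; lia
    · simp; lia
  · intro h
    simp [MvPolynomial.notMem_support_iff.1 h]

theorem degreeOf_perturbed_le {R₀ : ℂ[X]} (hR₀ : R₀.natDegree ≤ d) (hP : P.totalDegree ≤ d)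
    (δ : ℂ) : (perturbed R₀ P δ).degreeOf 1 ≤ d := by
  refine (MvPolynomial.degreeOf_add_le _ _ _).trans (max_le ?_ ?_)
  · refine (MvPolynomial.degreeOf_le_totalDegree _ _).trans ?_
    rw [Polynomial.aeval_eq_sum_range]
    refine MvPolynomial.totalDegree_finsetSum_le fun i hi => ?_
    refine (MvPolynomial.totalDegree_smul_le _ _).trans ?_
    rw [MvPolynomial.totalDegree_X_pow]
    exact (Finset.mem_range_succ_iff.1 hi).trans hR₀
  · exact (MvPolynomial.degreeOf_C_mul_le _ _ _).trans
      ((MvPolynomial.degreeOf_le_totalDegree _ _).trans hP)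

end Slice

section Correspondence

variable {R : MvPolynomial (Fin 2) ℂ} {d : ℕ} {r : ℝ}

/-- Every slice `R(z, ·)` with `z ∈ ℂ` has degree `d`, the degree of `R` in `w`, so that no fibre
over a point of `ℂ` contains `∞`. -/
structure HasFullDegree (R : MvPolynomial (Fin 2) ℂ) (d : ℕ) : Prop where
  degreeOf_le : R.degreeOf 1 ≤ d
  natDegree_slice : ∀ z : ℂ, (slice R z).natDegree = d

theorem HasFullDegree.fiber_coe (hR : HasFullDegree R d) (z : ℂ) :
    fiber R z = (slice R z).roots.map fun w : ℂ => (w : Sphere) := by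
  rw [fiber, Nat.sub_eq_zero_of_le (hR.degreeOf_le.trans (hR.natDegree_slice z).ge),
    Multiset.replicate_zero, add_zero]
  simp [Multiset.bind_def, Multiset.pure_def]

theorem HasFullDegree.card_fiber (hR : HasFullDegree R d) (z : ℂ) : (fiber R z).card = d := by
  rw [hR.fiber_coe, Multiset.card_map, ← (IsAlgClosed.splits _).natDegree_eq_card_roots,
    hR.natDegree_slice]

theorem HasFullDegree.mem_fiber_coe (hR : HasFullDegree R d) (hd : d ≠ 0) {z : ℂ} {x : Sphere} :
    x ∈ fiber R z ↔ ∃ w : ℂ, MvPolynomial.eval ![z, w] R = 0 ∧ (w : Sphere) = x := by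
  have hne : slice R z ≠ 0 := fun h => hd (by simpa [h] using (hR.natDegree_slice z).symm)
  simp only [hR.fiber_coe, Multiset.mem_map, Polynomial.mem_roots hne, Polynomial.IsRoot,
    eval_slice]

/-- Outside the disc of radius `r` the correspondence at least halves the modulus, and it maps the
disc of radius `r` into the disc of radius `r / 2`. -/
def AbsorbsInto (R : MvPolynomial (Fin 2) ℂ) (r : ℝ) : Prop :=
  ∀ z w : ℂ, MvPolynomial.eval ![z, w] R = 0 → ‖w‖ ≤ max r ‖z‖ / 2

theorem AbsorbsInto.induction (hR : AbsorbsInto R r) (hr : 0 < r) {p : ℂ → Prop}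
    (hdisc : ∀ z, ‖z‖ ≤ r → p z)
    (hstep : ∀ z, (∀ w, MvPolynomial.eval ![z, w] R = 0 → p w) → p z) (z : ℂ) : p z := by
  have key : ∀ (n : ℕ) (z : ℂ), ‖z‖ ≤ 2 ^ n * r → p z := by
    intro n
    induction n with
    | zero => simpa using hdisc
    | succ n ih =>
      refine fun z hz => hstep z fun w hw => ih w ((hR z w hw).trans ?_)
      have hmax : max r ‖z‖ ≤ 2 ^ (n + 1) * r :=
        max_le (le_mul_of_one_le_left hr.le (one_le_pow₀ one_le_two)) hz
      rw [pow_succ] at hmax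
      linarith
  obtain ⟨n, hn⟩ := pow_unbounded_of_one_lt (‖z‖ / r) one_lt_two
  exact key n z ((div_le_iff₀ hr).1 hn.le)

theorem mem_image_coe_of_compact {K : Set ℂ} (hK : IsCompact K) {z : ℂ} (hz : K ∈ 𝓝 z) {ρ : ℝ}
    (hρ : ∀ z' ∈ K, ∀ w, MvPolynomial.eval ![z', w] R = 0 → ‖w‖ ≤ ρ) {x : Sphere} :
    x ∈ image R z ↔ ∃ w : ℂ, MvPolynomial.eval ![z, w] R = 0 ∧ (w : Sphere) = x := by
  refine ⟨fun hx => ?_, ?_⟩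
  · let T : Set (ℂ × ℂ) := {p | MvPolynomial.eval ![p.1, p.2] R = 0} ∩
      K ×ˢ Metric.closedBall 0 ρ
    let c : ℂ × ℂ → Sphere × Sphere := Prod.map (↑) (↑)
    have hc : Continuous c := OnePoint.continuous_coe.prodMap OnePoint.continuous_coe
    have hT : IsCompact T :=
      (hK.prod (isCompact_closedBall _ _)).inter_left <| isClosed_eq
        ((MvPolynomial.continuous_eval R).comp (by fun_prop)) continuous_const
    have hG : IsOpen (((↑) '' interior K : Set Sphere) ×ˢ (Set.univ : Set Sphere)) :=
      (OnePoint.isOpen_image_coe.2 isOpen_interior).prod isOpen_univ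
    have hmem : ((z : Sphere), x) ∈ closure (c '' T) := by
      refine closure_mono ?_ (hG.inter_closure
        ⟨⟨Set.mem_image_of_mem _ (mem_interior_iff_mem_nhds.2 hz), trivial⟩, hx⟩)
      rintro _ ⟨⟨⟨z', hz', hzz⟩, -⟩, z'', w, h0, rfl⟩
      obtain rfl := OnePoint.coe_injective hzz
      exact ⟨(z', w), ⟨h0, interior_subset hz',
        mem_closedBall_zero_iff.2 (hρ z' (interior_subset hz') w h0)⟩, rfl⟩
    obtain ⟨⟨z', w⟩, ⟨h0, -⟩, heq⟩ := (hT.image hc).isClosed.closure_subset hmem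
    obtain ⟨h1, rfl⟩ := Prod.mk.inj heq
    obtain rfl := OnePoint.coe_injective h1
    exact ⟨w, h0, rfl⟩
  · rintro ⟨w, h0, rfl⟩
    exact subset_closure ⟨z, w, h0, rfl⟩

theorem AbsorbsInto.mem_image_coe (hR : AbsorbsInto R r) {z : ℂ} {x : Sphere} :
    x ∈ image R z ↔ ∃ w : ℂ, MvPolynomial.eval ![z, w] R = 0 ∧ (w : Sphere) = x := by
  refine mem_image_coe_of_compact (isCompact_closedBall z 1)
    (Metric.closedBall_mem_nhds z one_pos) (ρ := max r (‖z‖ + 1) / 2) fun z' hz' w hw => ?_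
  have hzz' : ‖z'‖ ≤ ‖z‖ + 1 := norm_le_norm_add_const_of_dist_le hz'
  refine (hR z' w hw).trans ?_
  gcongr

theorem mem_image_coe_iff_mem_fiber (hd : d ≠ 0) (hdeg : HasFullDegree R d)
    (habs : AbsorbsInto R r) {z : ℂ} {x : Sphere} : x ∈ image R z ↔ x ∈ fiber R z :=
  habs.mem_image_coe.trans (hdeg.mem_fiber_coe hd).symm

theorem forall_mem_iter {F : Sphere → Multiset Sphere} {p : Sphere → Prop} {a : Sphere} (ha : p a)
    (hstep : ∀ x, p x → ∀ y ∈ F x, p y) (m : ℕ) : ∀ x ∈ iter F m a, p x := by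
  induction m with
  | zero =>
    intro x hx
    rwa [Multiset.mem_singleton.1 hx]
  | succ m ih =>
    intro y hy
    obtain ⟨x, hx, hxy⟩ := Multiset.mem_bind.1 hy
    exact hstep x (ih x hx) y hxy

theorem ForwardInvariant.forall_mem_iter (hd : d ≠ 0) (hdeg : HasFullDegree R d) {S : Set Sphere}
    (hS : ForwardInvariant R S) {a : ℂ} (ha : (a : Sphere) ∈ S) (m : ℕ) :
    ∀ x ∈ iter (fiber R) m a, x ∈ S := by
  suffices h : ∀ x ∈ iter (fiber R) m a, x ∈ S ∧ ∃ z : ℂ, (z : Sphere) = x from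
    fun x hx => (h x hx).1
  refine HolCorr.forall_mem_iter ⟨ha, a, rfl⟩ ?_ m
  rintro _ ⟨hzS, z, rfl⟩ y hy
  obtain ⟨w, hw, rfl⟩ := (hdeg.mem_fiber_coe hd).1 hy
  exact ⟨hS (Set.mem_biUnion hzS (subset_closure ⟨z, w, hw, rfl⟩)), w, rfl⟩

end Correspondence

section Equilibrium

/-- The inclusion into the sphere of the closed disc of radius `r` around the origin. -/
def discCoe (r : ℝ) (z : Metric.closedBall (0 : ℂ) r) : Sphere := ((z : ℂ) : Sphere)

theorem isClosedEmbedding_discCoe (r : ℝ) : IsClosedEmbedding (discCoe r) :=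
  (OnePoint.continuous_coe.comp continuous_subtype_val).isClosedEmbedding
    (OnePoint.coe_injective.comp Subtype.val_injective)

theorem regular_map_discCoe (r : ℝ) (ν : Measure (Metric.closedBall (0 : ℂ) r))
    [IsFiniteMeasure ν] : (ν.map (discCoe r)).Regular := by
  have := Measure.InnerRegular.map_of_continuous (μ := ν) (isClosedEmbedding_discCoe r).continuous
  infer_instance

variable {R : MvPolynomial (Fin 2) ℂ} {r : ℝ} {ι : Type*} [Fintype ι] [Nonempty ι]
  {g : ι → Metric.closedBall (0 : ℂ) r → Metric.closedBall (0 : ℂ) r}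
  {ν : Measure (Metric.closedBall (0 : ℂ) r)}

theorem support_map_discCoe (ν : Measure (Metric.closedBall (0 : ℂ) r)) :
    (ν.map (discCoe r)).support = discCoe r '' ν.support :=
  have hj := isClosedEmbedding_discCoe r
  support_map_of_isClosedMap hj.continuous hj.isClosedMap ν

theorem weakStarTendsto_equilibrium [IsProbabilityMeasure ν] (hr : 0 < r)
    (hdeg : HasFullDegree R (Fintype.card ι)) (habs : AbsorbsInto R r)
    (hF : IsBranchSystem (fiber R) (discCoe r) g) {K : NNReal} (hK : K < 1)
    (hg : ∀ i, LipschitzWith K (g i)) (hν : IsStationary g ν) (a : ℂ) :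
    WeakStarTendsto (fun m => ((Fintype.card ι : ℝ≥0∞) ^ m)⁻¹ •
      pushforward (iter (fiber R) m) (Measure.dirac (a : Sphere))) (ν.map (discCoe r)) := by
  intro φ
  have hj := (isClosedEmbedding_discCoe r).continuous
  simp only [integral_pushforward_iter_dirac]
  rw [integral_map hj.aemeasurable φ.continuous.aestronglyMeasurable]
  induction a using habs.induction hr with
  | hdisc z hz =>
    have h := hν.tendsto_transfer_pow hK hg (φ.continuous.comp hj) ⟨z, mem_closedBall_zero_iff.2 hz⟩
    simp only [← hF.fiberAverage_iterate] at h
    exact h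
  | hstep z ih =>
    refine tendsto_fiberAverage_iterate Fintype.card_ne_zero (hdeg.card_fiber z) fun x hx => ?_
    obtain ⟨w, hw, rfl⟩ := (hdeg.mem_fiber_coe Fintype.card_ne_zero).1 hx
    exact ih w hw

theorem support_equilibrium_subset_thickening (hg : ∀ i, Continuous (g i))
    (hν : IsStationary g ν) {S : Set ℂ} {ε : ℝ}
    (hS : ∀ i z, (g i z : ℂ) ∈ Metric.thickening ε S) :
    (ν.map (discCoe r)).support ⊆ (fun z : ℂ => (z : Sphere)) '' Metric.thickening ε S := by
  rw [support_map_discCoe, Set.image_subset_iff]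
  intro z hz
  obtain ⟨i, y, rfl⟩ := Set.mem_iUnion.1 (hν.support_subset_iUnion_range hg hz)
  exact ⟨_, hS i y, rfl⟩

theorem forwardInvariant_support_equilibrium (hdeg : HasFullDegree R (Fintype.card ι))
    (habs : AbsorbsInto R r) (hF : IsBranchSystem (fiber R) (discCoe r) g)
    (hg : ∀ i, Continuous (g i)) (hν : IsStationary g ν) :
    ForwardInvariant R (ν.map (discCoe r)).support := by
  rw [support_map_discCoe]
  refine Set.iUnion₂_subset ?_
  rintro _ ⟨z, hz, rfl⟩ x hx
  have hx' := (mem_image_coe_iff_mem_fiber Fintype.card_ne_zero hdeg habs).1 hx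
  rw [← discCoe, hF z] at hx'
  obtain ⟨i, -, rfl⟩ := Multiset.mem_map.1 hx'
  exact Set.mem_image_of_mem _ (hν.mapsTo_support hg i hz)

theorem exists_coe_mem_support_map_discCoe [NeZero ν] :
    ∃ a : ℂ, (a : Sphere) ∈ (ν.map (discCoe r)).support := by
  obtain ⟨z, hz⟩ := ν.nonempty_support (NeZero.ne ν)
  exact ⟨z, support_map_discCoe ν ▸ Set.mem_image_of_mem _ hz⟩

theorem support_subset_of_weakStarTendsto {μ : Measure Sphere} [IsFiniteMeasure μ] {d : ℕ}
    (hd : d ≠ 0) (hdeg : HasFullDegree R d) {a : ℂ}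
    (h : WeakStarTendsto (fun m => ((d : ℝ≥0∞) ^ m)⁻¹ •
      pushforward (iter (fiber R) m) (Measure.dirac (a : Sphere))) μ)
    {S : Set Sphere} (hS : IsClosed S) (hRS : ForwardInvariant R S) (ha : (a : Sphere) ∈ S) :
    μ.support ⊆ S := by
  refine h.support_subset hS fun m => Measure.ae_smul_measure ?_ _
  rw [pushforward_dirac]
  exact ae_multiset_sum_dirac (hRS.forall_mem_iter hd hdeg ha m)

theorem isLeast_support_equilibrium [IsProbabilityMeasure ν] (hr : 0 < r)
    (hdeg : HasFullDegree R (Fintype.card ι)) (habs : AbsorbsInto R r)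
    (hF : IsBranchSystem (fiber R) (discCoe r) g) {K : NNReal} (hK : K < 1)
    (hg : ∀ i, LipschitzWith K (g i)) (hν : IsStationary g ν) :
    IsLeast {S : Set Sphere | IsClosed S ∧ ForwardInvariant R S ∧ ∃ a : ℂ, (a : Sphere) ∈ S}
      (ν.map (discCoe r)).support := by
  refine ⟨⟨Measure.isClosed_support, forwardInvariant_support_equilibrium hdeg habs hF
    (fun i => (hg i).continuous) hν, exists_coe_mem_support_map_discCoe⟩, ?_⟩
  rintro S ⟨hS, hRS, a, ha⟩
  exact support_subset_of_weakStarTendsto Fintype.card_ne_zero hdeg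
    (weakStarTendsto_equilibrium hr hdeg habs hF hK hg hν a) hS hRS ha

end Equilibrium

section Estimates

theorem norm_eval_le_of_totalDegree_le {σ K : Type*} [NormedField K] {P : MvPolynomial σ K} {d : ℕ}
    (hP : P.totalDegree ≤ d) {N : ℝ} (hN : 1 ≤ N) {x : σ → K} (hx : ∀ i, ‖x i‖ ≤ N) :
    ‖MvPolynomial.eval x P‖ ≤ (∑ m ∈ P.support, ‖P.coeff m‖) * N ^ d := by
  rw [MvPolynomial.eval_eq, Finset.sum_mul]
  refine norm_sum_le_of_le _ fun m hm => ?_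
  rw [norm_mul, norm_prod]
  gcongr
  calc ∏ i ∈ m.support, ‖x i ^ m i‖ ≤ ∏ i ∈ m.support, N ^ m i := by
        gcongr with i _
        rw [norm_pow]
        gcongr
        exact hx i
    _ = N ^ m.sum fun _ e => e := Finset.prod_pow_eq_pow_sum _ _ _
    _ ≤ N ^ d := pow_le_pow_right₀ hN ((MvPolynomial.le_totalDegree hm).trans hP)

theorem exists_pos_mul_norm_pow_le_norm_eval {K : Type*} [NormedField K] {p : K[X]} (hp : p ≠ 0) :
    ∃ c > 0, ∀ᶠ w in Bornology.cobounded K, c * ‖w‖ ^ p.natDegree ≤ ‖p.eval w‖ := by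
  obtain ⟨C, hC, h⟩ :=
    (Polynomial.isEquivalent_cobounded_leading_monomial (P := p)).isTheta.isBigO_symm.exists_pos
  have hlc : 0 < ‖p.leadingCoeff‖ := norm_pos_iff.2 (Polynomial.leadingCoeff_ne_zero.2 hp)
  refine ⟨‖p.leadingCoeff‖ / C, div_pos hlc hC, h.bound.mono fun w hw => ?_⟩
  rwa [norm_mul, norm_pow, ← div_le_iff₀' hC, ← div_mul_eq_mul_div] at hw

theorem exists_mem_roots_dist_lt {K : Type*} [NormedField K] {p : K[X]} (hp : p.Splits) {ζ : K}
    {η : ℝ} (hη : 0 ≤ η) (h : ‖p.eval ζ‖ < ‖p.leadingCoeff‖ * η ^ p.natDegree) :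
    ∃ w ∈ p.roots, dist ζ w < η := by
  by_contra! hfar
  have hprod : ‖(p.roots.map fun w => ζ - w).prod‖ = (p.roots.map fun w => dist ζ w).prod := by
    simp only [dist_eq_norm]
    exact (map_multiset_prod (normHom : K →*₀ ℝ) _).trans (by rw [Multiset.map_map]; rfl)
  refine h.not_ge ?_
  rw [hp.eval_eq_prod_roots, norm_mul, hprod, hp.natDegree_eq_card_roots,
    ← Multiset.prod_replicate, ← Multiset.map_const']
  gcongr
  exact Multiset.prod_map_le_prod_map₀ _ _ (fun _ _ => hη) hfar

theorem eventually_norm_sub_le_near_roots {p : ℂ[X]} (hp : p.Separable) :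
    ∃ C ≥ 0, ∀ᶠ η in 𝓝[>] (0 : ℝ), ∀ ζ : p.rootSet ℂ, ∀ w ∈ Metric.ball (ζ : ℂ) η,
      ∀ w' ∈ Metric.ball (ζ : ℂ) η, ‖w - w'‖ ≤ C * ‖p.eval w - p.eval w'‖ := by
  have hO : ∀ ζ : p.rootSet ℂ, (fun q : ℂ × ℂ => q.1 - q.2) =O[𝓝 ((ζ : ℂ), (ζ : ℂ))]
      fun q => p.eval q.1 - p.eval q.2 := fun ζ => by
    have hne := hp.aeval_derivative_ne_zero (Polynomial.aeval_eq_zero_of_mem_rootSet ζ.2)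
    rw [Polynomial.coe_aeval_eq_eval] at hne
    exact (HasDerivAtFilter.isTheta_sub (p.hasStrictDerivAt (ζ : ℂ)) hne).isBigO_symm
  obtain ⟨C, hC, h⟩ := ((eventually_ge_atTop (0 : ℝ)).and
    (eventually_all.2 fun ζ => Asymptotics.isBigO_iff_eventually_isBigOWith.1 (hO ζ))).exists
  refine ⟨C, hC, eventually_all.2 fun ζ => ?_⟩
  obtain ⟨e, he, hball⟩ := Metric.eventually_nhds_iff_ball.1 (h ζ).bound
  filter_upwards [Ioo_mem_nhdsGT he] with η hη w hw w' hw'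
  refine hball (w, w') ?_
  rw [← ball_prod_same]
  exact ⟨Metric.ball_subset_ball hη.2.le hw, Metric.ball_subset_ball hη.2.le hw'⟩

theorem continuous_eval_pair (P : MvPolynomial (Fin 2) ℂ) :
    Continuous fun p : ℂ × ℂ => MvPolynomial.eval ![p.1, p.2] P :=
  (MvPolynomial.continuous_eval P).comp (by fun_prop)

theorem exists_lipschitzOnWith_eval_pair (P : MvPolynomial (Fin 2) ℂ) {S : Set (ℂ × ℂ)}
    (hS : IsCompact S) :
    ∃ L, LipschitzOnWith L (fun p : ℂ × ℂ => MvPolynomial.eval ![p.1, p.2] P) S := by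
  have h : ContDiff ℂ 1 fun p : ℂ × ℂ => MvPolynomial.eval ![p.1, p.2] P :=
    (AnalyticOnNhd.eval_mvPolynomial (𝕜 := ℂ) P).contDiff.comp
      (contDiff_pi.2 (Fin.forall_fin_two.2 ⟨contDiff_fst, contDiff_snd⟩))
  exact h.locallyLipschitz.locallyLipschitzOn.exists_lipschitzOnWith_of_compact hS

end Estimates

section Perturbation

variable {R₀ : ℂ[X]} {P : MvPolynomial (Fin 2) ℂ}

theorem exists_eventually_absorbsInto (hR₀ : R₀ ≠ 0) (hP : P.totalDegree ≤ R₀.natDegree) :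
    ∃ r > 0, ∀ᶠ δ in 𝓝 (0 : ℂ), AbsorbsInto (perturbed R₀ P δ) r := by
  obtain ⟨c, hc, hlarge⟩ := exists_pos_mul_norm_pow_le_norm_eval hR₀
  obtain ⟨ρ, -, hρ⟩ := (hasBasis_cobounded_norm (E := ℂ)).eventually_iff.1 hlarge
  set B := ∑ m ∈ P.support, ‖P.coeff m‖
  have hsmall : ∀ᶠ δ in 𝓝 (0 : ℂ), ‖δ‖ * (B * 2 ^ R₀.natDegree) < c :=
    ContinuousAt.eventually_lt (by fun_prop) continuousAt_const (by simpa using hc)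
  refine ⟨max 1 (2 * ρ), by positivity, hsmall.mono fun δ hδ z w hzw => ?_⟩
  by_contra! hw
  obtain ⟨⟨hw1, hwρ⟩, hwz⟩ : (1 < 2 * ‖w‖ ∧ 2 * ρ < 2 * ‖w‖) ∧ ‖z‖ < 2 * ‖w‖ := by
    rwa [div_lt_iff₀' two_pos, max_lt_iff, max_lt_iff] at hw
  rw [eval_perturbed, add_eq_zero_iff_eq_neg] at hzw
  refine hδ.not_ge (le_of_mul_le_mul_right ?_ (pow_pos (show 0 < ‖w‖ by linarith) R₀.natDegree))
  calc c * ‖w‖ ^ R₀.natDegree ≤ ‖R₀.eval w‖ := hρ (show ρ ≤ ‖w‖ by linarith)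
    _ = ‖δ‖ * ‖MvPolynomial.eval ![z, w] P‖ := by rw [hzw, norm_neg, norm_mul]
    _ ≤ ‖δ‖ * (B * (2 * ‖w‖) ^ R₀.natDegree) := by
        gcongr
        refine norm_eval_le_of_totalDegree_le hP hw1.le (Fin.forall_fin_two.2 ⟨hwz.le, ?_⟩)
        exact le_mul_of_one_le_left (norm_nonneg w) one_le_two
    _ = ‖δ‖ * (B * 2 ^ R₀.natDegree) * ‖w‖ ^ R₀.natDegree := by ring

theorem coeff_slice_perturbed (hP : P.totalDegree ≤ R₀.natDegree) (δ z : ℂ) :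
    (slice (perturbed R₀ P δ) z).coeff R₀.natDegree =
      R₀.leadingCoeff + δ * P.coeff (Finsupp.single 1 R₀.natDegree) := by
  rw [slice_perturbed, Polynomial.coeff_add, Polynomial.coeff_C_mul, coeff_slice hP,
    Polynomial.coeff_natDegree]

theorem eventually_hasFullDegree (hR₀ : R₀ ≠ 0) (hP : P.totalDegree ≤ R₀.natDegree) :
    ∀ᶠ δ in 𝓝 (0 : ℂ), HasFullDegree (perturbed R₀ P δ) R₀.natDegree := by
  have hlc : ∀ᶠ δ in 𝓝 (0 : ℂ),
      R₀.leadingCoeff + δ * P.coeff (Finsupp.single 1 R₀.natDegree) ≠ 0 :=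
    ContinuousAt.eventually_ne (by fun_prop) (by simpa using hR₀)
  filter_upwards [hlc] with δ hδ
  refine ⟨degreeOf_perturbed_le le_rfl hP δ, fun z => le_antisymm ?_ ?_⟩
  · rw [slice_perturbed]
    exact Polynomial.natDegree_add_le_of_degree_le le_rfl
      ((Polynomial.natDegree_C_mul_le _ _).trans (natDegree_slice_le hP z))
  · exact Polynomial.le_natDegree_of_ne_zero (by rwa [coeff_slice_perturbed hP])

theorem eventually_exists_mem_roots_slice (hR₀ : R₀ ≠ 0) (hP : P.totalDegree ≤ R₀.natDegree)
    {S : Set ℂ} (hS : IsCompact S) {ζ : ℂ} (hζ : R₀.IsRoot ζ) {η : ℝ} (hη : 0 < η) :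
    ∀ᶠ δ in 𝓝 (0 : ℂ), ∀ z ∈ S, ∃ w ∈ (slice (perturbed R₀ P δ) z).roots, dist ζ w < η := by
  obtain ⟨M, hM⟩ := hS.exists_bound_of_continuousOn
    ((continuous_eval_pair P).comp (continuous_id.prodMk continuous_const)).continuousOn
  have hsmall : ∀ᶠ δ in 𝓝 (0 : ℂ), ‖δ‖ * M <
      ‖R₀.leadingCoeff + δ * P.coeff (Finsupp.single 1 R₀.natDegree)‖ * η ^ R₀.natDegree :=
    ContinuousAt.eventually_lt (by fun_prop) (by fun_prop) (by simp [hR₀, hη])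
  filter_upwards [hsmall, eventually_hasFullDegree hR₀ hP] with δ hδ hdeg z hz
  refine exists_mem_roots_dist_lt (IsAlgClosed.splits _) hη.le ?_
  rw [eval_slice, eval_perturbed, hζ.eq_zero, zero_add, norm_mul, Polynomial.leadingCoeff,
    hdeg.natDegree_slice, coeff_slice_perturbed hP]
  refine lt_of_le_of_lt ?_ hδ
  gcongr
  exact hM z hz

end Perturbation

section Branches

theorem eventually_pairwise_two_mul_le_dist {X ι : Type*} [MetricSpace X] [Finite ι] {c : ι → X}
    (hc : Function.Injective c) :
    ∀ᶠ η in 𝓝[>] (0 : ℝ), Pairwise fun i k => 2 * η ≤ dist (c i) (c k) := by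
  refine Eventually.filter_mono nhdsWithin_le_nhds (eventually_all.2 fun i =>
    eventually_all.2 fun k => eventually_imp_distrib_left.2 fun hik => ?_)
  refine (ContinuousAt.eventually_lt (by fun_prop) continuousAt_const ?_).mono fun _ => le_of_lt
  simpa using hc.ne hik

theorem exists_eq_map_of_mem_balls {X ι : Type*} [PseudoMetricSpace X] [Fintype ι] {c : ι → X}
    {η : ℝ} (hsep : Pairwise fun i k => 2 * η ≤ dist (c i) (c k)) {s : Multiset X}
    (hcard : s.card ≤ Fintype.card ι) (h : ∀ i, ∃ w ∈ s, dist (c i) w < η) :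
    ∃ g : ι → X, (∀ i, dist (c i) (g i) < η) ∧ s = Finset.univ.val.map g := by
  choose g hg hd using h
  refine ⟨g, hd, (Multiset.eq_of_le_of_card_le ?_ (by simpa using hcard)).symm⟩
  have hinj : Function.Injective g := fun i k hik => by
    by_contra hne
    have hdist := dist_triangle_right (c i) (c k) (g i)
    have hk := hd k
    rw [← hik] at hk
    linarith [hsep hne, hd i]
  rw [Multiset.le_iff_subset (Finset.univ.nodup.map hinj)]
  intro x hx
  obtain ⟨i, -, rfl⟩ := Multiset.mem_map.1 hx
  exact hg i

variable {R : MvPolynomial (Fin 2) ℂ} {r η : ℝ} {ι : Type*} [Fintype ι]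
  {g : ι → Metric.closedBall (0 : ℂ) r → Metric.closedBall (0 : ℂ) r}

theorem exists_isBranchSystem (hdeg : HasFullDegree R (Fintype.card ι)) (habs : AbsorbsInto R r)
    {c : ι → ℂ} (hsep : Pairwise fun i k => 2 * η ≤ dist (c i) (c k))
    (hroot : ∀ i, ∀ z ∈ Metric.closedBall (0 : ℂ) r, ∃ w ∈ (slice R z).roots, dist (c i) w < η) :
    ∃ g : ι → Metric.closedBall (0 : ℂ) r → Metric.closedBall (0 : ℂ) r,
      IsBranchSystem (fiber R) (discCoe r) g ∧ ∀ i z, dist (c i) (g i z) < η := by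
  have hcard : ∀ z : ℂ, (slice R z).roots.card = Fintype.card ι := fun z => by
    rw [← (IsAlgClosed.splits _).natDegree_eq_card_roots, hdeg.natDegree_slice]
  choose h hη hroots using fun z : Metric.closedBall (0 : ℂ) r =>
    exists_eq_map_of_mem_balls hsep (hcard z).le fun i => hroot i z z.2
  have hmaps : ∀ i z, h z i ∈ Metric.closedBall (0 : ℂ) r := fun i z => by
    have hmem : h z i ∈ (slice R (z : ℂ)).roots :=
      hroots z ▸ Multiset.mem_map_of_mem _ (Finset.mem_univ i)
    have hle := habs z (h z i) (by
      rw [← eval_slice]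
      exact Polynomial.isRoot_of_mem_roots hmem)
    have hz := mem_closedBall_zero_iff.1 z.2
    rw [max_eq_left hz] at hle
    rw [mem_closedBall_zero_iff]
    linarith [norm_nonneg (z : ℂ)]
  refine ⟨fun i z => ⟨h z i, hmaps i z⟩, fun z => ?_, fun i z => hη z i⟩
  rw [discCoe, hdeg.fiber_coe, hroots, Multiset.map_map]
  rfl

theorem IsBranchSystem.eval_eq_zero [Nonempty ι] (hdeg : HasFullDegree R (Fintype.card ι))
    (hF : IsBranchSystem (fiber R) (discCoe r) g) (i : ι) (z : Metric.closedBall (0 : ℂ) r) :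
    MvPolynomial.eval ![(z : ℂ), g i z] R = 0 := by
  have hmem : discCoe r (g i z) ∈ fiber R (discCoe r z) :=
    hF z ▸ Multiset.mem_map_of_mem _ (Finset.mem_univ i)
  obtain ⟨w, hw, hwg⟩ := (hdeg.mem_fiber_coe Fintype.card_ne_zero).1 hmem
  rwa [OnePoint.coe_injective hwg] at hw

variable {R₀ : ℂ[X]} {P : MvPolynomial (Fin 2) ℂ}

theorem lipschitzWith_half_of_eval_eq_zero {δ : ℂ} {C : ℝ} (hC : 0 ≤ C) {L : NNReal}
    (hδ : C * (‖δ‖ * L) ≤ 1 / 2) {U : Set ℂ}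
    (hexp : ∀ w ∈ U, ∀ w' ∈ U, ‖w - w'‖ ≤ C * ‖R₀.eval w - R₀.eval w'‖) {S : Set ℂ}
    (hL : LipschitzOnWith L (fun p : ℂ × ℂ => MvPolynomial.eval ![p.1, p.2] P) (S ×ˢ S))
    {h : S → S} (hU : ∀ z, (h z : ℂ) ∈ U)
    (hzero : ∀ z : S, MvPolynomial.eval ![(z : ℂ), h z] (perturbed R₀ P δ) = 0) :
    LipschitzWith (1 / 2) h := by
  refine LipschitzWith.of_dist_le_mul fun z z' => ?_
  have hR₀ : R₀.eval (h z : ℂ) - R₀.eval (h z' : ℂ) =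
      -(δ * (MvPolynomial.eval ![(z : ℂ), h z] P - MvPolynomial.eval ![(z' : ℂ), h z'] P)) := by
    have hz := hzero z
    have hz' := hzero z'
    rw [eval_perturbed] at hz hz'
    linear_combination hz - hz'
  have hPL : ‖MvPolynomial.eval ![(z : ℂ), h z] P - MvPolynomial.eval ![(z' : ℂ), h z'] P‖ ≤
      L * max (dist z z') (dist (h z) (h z')) := by
    rw [← dist_eq_norm]
    exact hL.dist_le_mul ((z : ℂ), (h z : ℂ)) ⟨z.2, (h z).2⟩ ((z' : ℂ), (h z' : ℂ))
      ⟨z'.2, (h z').2⟩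
  have hle : dist (h z) (h z') ≤ 1 / 2 * max (dist z z') (dist (h z) (h z')) :=
    calc dist (h z) (h z') = ‖(h z : ℂ) - h z'‖ := dist_eq_norm (h z : ℂ) _
      _ ≤ C * (‖δ‖ * ‖MvPolynomial.eval ![(z : ℂ), h z] P -
            MvPolynomial.eval ![(z' : ℂ), h z'] P‖) := by
          rw [← norm_mul, ← norm_neg (δ * _), ← hR₀]
          exact hexp _ (hU z) _ (hU z')
      _ ≤ C * (‖δ‖ * (L * max (dist z z') (dist (h z) (h z')))) := by
          gcongr
      _ = C * (‖δ‖ * L) * max (dist z z') (dist (h z) (h z')) := by ring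
      _ ≤ 1 / 2 * max (dist z z') (dist (h z) (h z')) := by gcongr
  push_cast
  rcases max_cases (dist z z') (dist (h z) (h z')) with ⟨hmax, -⟩ | ⟨hmax, -⟩ <;> rw [hmax] at hle
  · exact hle
  · linarith [dist_nonneg (x := z) (y := z')]

end Branches

section ContractingBranches

theorem separable_of_forall_rootMultiplicity_eq_one {K : Type*} [Field K] [IsAlgClosed K]
    {p : K[X]} (hp : p ≠ 0) (h : ∀ ζ, p.IsRoot ζ → p.rootMultiplicity ζ = 1) : p.Separable := by
  classical
  refine (Polynomial.nodup_roots_iff_of_splits hp (IsAlgClosed.splits p)).1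
    (Multiset.nodup_iff_count_le_one.2 fun ζ => ?_)
  rw [Polynomial.count_roots]
  by_cases hζ : p.IsRoot ζ
  · exact (h ζ hζ).le
  · exact (Polynomial.rootMultiplicity_eq_zero hζ).trans_le zero_le_one

theorem isRoot_of_mem_rootSet {K : Type*} [Field K] {p : K[X]} {ζ : K} (hζ : ζ ∈ p.rootSet K) :
    p.IsRoot ζ := by
  have h := Polynomial.aeval_eq_zero_of_mem_rootSet hζ
  rwa [Polynomial.coe_aeval_eq_eval] at h

variable {R₀ : ℂ[X]} {P : MvPolynomial (Fin 2) ℂ}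

theorem eventually_exists_contracting_branches (hsep : R₀.Separable)
    (hP : P.totalDegree ≤ R₀.natDegree) {r : ℝ}
    (habs : ∀ᶠ δ in 𝓝 (0 : ℂ), AbsorbsInto (perturbed R₀ P δ) r) {ε : ℝ} (hε : 0 < ε) :
    ∀ᶠ δ in 𝓝 (0 : ℂ),
      ∃ g : R₀.rootSet ℂ → Metric.closedBall (0 : ℂ) r → Metric.closedBall (0 : ℂ) r,
        IsBranchSystem (fiber (perturbed R₀ P δ)) (discCoe r) g ∧
          (∀ ζ, LipschitzWith (1 / 2) (g ζ)) ∧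
            ∀ (ζ : R₀.rootSet ℂ) z, dist (ζ : ℂ) (g ζ z) < ε := by
  have hcard : Fintype.card (R₀.rootSet ℂ) = R₀.natDegree :=
    Polynomial.card_rootSet_eq_natDegree hsep (IsAlgClosed.splits _)
  have hdisc := isCompact_closedBall (0 : ℂ) r
  obtain ⟨C, hC, hexp⟩ := eventually_norm_sub_le_near_roots hsep
  obtain ⟨L, hL⟩ := exists_lipschitzOnWith_eval_pair P (hdisc.prod hdisc)
  obtain ⟨η, hηexp, hηsep, hη, hηε⟩ := (hexp.and ((eventually_pairwise_two_mul_le_dist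
    (Subtype.val_injective (p := (· ∈ R₀.rootSet ℂ)))).and (Ioo_mem_nhdsGT hε))).exists
  have hroots := eventually_all.2 fun ζ : R₀.rootSet ℂ =>
    eventually_exists_mem_roots_slice hsep.ne_zero hP hdisc (isRoot_of_mem_rootSet ζ.2) hη
  have hsmall : ∀ᶠ δ in 𝓝 (0 : ℂ), C * (‖δ‖ * L) < 1 / 2 :=
    ContinuousAt.eventually_lt (by fun_prop) continuousAt_const (by simp)
  filter_upwards [habs, eventually_hasFullDegree hsep.ne_zero hP, hroots, hsmall]
    with δ habs hdeg hroots hsmall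
  rw [← hcard] at hdeg
  obtain ⟨g, hF, hg⟩ := exists_isBranchSystem hdeg habs hηsep hroots
  refine ⟨g, hF, fun ζ => ?_, fun ζ z => (hg ζ z).trans hηε⟩
  have : Nonempty (R₀.rootSet ℂ) := ⟨ζ⟩
  exact lipschitzWith_half_of_eval_eq_zero hC hsmall.le (hηexp ζ) hL
    (fun z => Metric.mem_ball'.2 (hg ζ z)) (hF.eval_eq_zero hdeg ζ)

end ContractingBranches

end HolCorr

open HolCorr

theorem theoremA (d : ℕ) (hd : 0 < d) (R₀ : Polynomial ℂ) (hR₀ : R₀.natDegree = d)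
    (hsimple : ∀ ζ : ℂ, R₀.IsRoot ζ → R₀.rootMultiplicity ζ = 1)
    (P : MvPolynomial (Fin 2) ℂ) (hP : P.totalDegree ≤ d) (ε : ℝ) (hε : 0 < ε) :
    ∃ Δ : ℝ, 0 < Δ ∧ ∀ δ : ℂ, ‖δ‖ < Δ →
      ∃ μ : MeasureTheory.Measure HolCorr.Sphere,
        MeasureTheory.IsProbabilityMeasure μ ∧ μ.Regular ∧
        HolCorr.pushforward (HolCorr.fiber (HolCorr.perturbed R₀ P δ)) μ = (d : ENNReal) • μ ∧
        (∀ a : ℂ, HolCorr.WeakStarTendsto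
          (fun m => ((d : ENNReal) ^ m)⁻¹ •
            HolCorr.pushforward (HolCorr.iter (HolCorr.fiber (HolCorr.perturbed R₀ P δ)) m)
              (MeasureTheory.Measure.dirac (a : HolCorr.Sphere))) μ) ∧
        μ.support ⊆ (fun z : ℂ => (z : HolCorr.Sphere)) ''
          Metric.thickening ε {ζ : ℂ | R₀.IsRoot ζ} ∧
        IsLeast {S : Set HolCorr.Sphere | IsClosed S ∧
            HolCorr.ForwardInvariant (HolCorr.perturbed R₀ P δ) S ∧
            ∃ a : ℂ, (a : HolCorr.Sphere) ∈ S} μ.support := by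
  obtain rfl := hR₀
  have hne : R₀ ≠ 0 := Polynomial.ne_zero_of_natDegree_gt hd
  have hsep := separable_of_forall_rootMultiplicity_eq_one hne hsimple
  obtain ⟨r, hr, habs⟩ := exists_eventually_absorbsInto hne hP
  obtain ⟨Δ, hΔ, h⟩ := Metric.eventually_nhds_iff.1 (habs.and ((eventually_hasFullDegree hne hP).and
    (eventually_exists_contracting_branches hsep hP habs hε)))
  refine ⟨Δ, hΔ, fun δ hδ => ?_⟩
  obtain ⟨habs, hdeg, g, hF, hg, hgε⟩ := h (by rwa [dist_zero_right])
  rw [← Polynomial.card_rootSet_eq_natDegree (K := ℂ) hsep (IsAlgClosed.splits _)] at hd hdeg ⊢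
  have : Nonempty (R₀.rootSet ℂ) := Fintype.card_pos_iff.1 hd
  have : Nonempty (Metric.closedBall (0 : ℂ) r) := ⟨0, Metric.mem_closedBall_self hr.le⟩
  have hg' := fun ζ => (hg ζ).continuous
  have hhalf : (1 / 2 : NNReal) < 1 := by norm_num
  have hj := isClosedEmbedding_discCoe r
  obtain ⟨ν, _, hν⟩ := exists_isStationary hhalf hg
  refine ⟨ν.map (discCoe r), Measure.isProbabilityMeasure_map hj.continuous.aemeasurable,
    regular_map_discCoe r ν,
    hν.pushforward_map hF hj.measurableEmbedding fun ζ => (hg' ζ).measurable,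
    weakStarTendsto_equilibrium hr hdeg habs hF hhalf hg hν,
    support_equilibrium_subset_thickening hg' hν fun ζ z => ?_,
    isLeast_support_equilibrium hr hdeg habs hF hhalf hg hν⟩
  exact Metric.mem_thickening_iff.2 ⟨ζ, isRoot_of_mem_rootSet ζ.2, dist_comm (ζ : ℂ) _ ▸ hgε ζ z⟩
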